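/- Let $G=(V,E)$ be a connected finite simple graph with a measure $\mu:V\to(0,\infty)$ and positive symmetric edge weights $w_{xy}=w_{yx}>0$ ($xy\in E$), and let $$\Delta u(x)=\frac1{\mu(x)}\sum_{y\sim x}w_{xy}\,(u(y)-u(x)),\qquad u:V\to\mathbb R .$$ Let $h_1,h_2:V\to\mathbb R$ with $h_1(x)>0$ for all $x\in V$, let $A,B>0$ be constants, and define $F_{h_1,h_2}:\mathbb R^V\to\mathbb R^V$ by $$F_{h_1,h_2}(u)=-\Delta u+h_1e^{Au}+h_2e^{-Bu}.$$ For $R>0$ put $B_R=\{u\in\mathbb R^V:\max_V|u|<R\}$. If $\max_V h_2<0$ or $\min_V h_2>0$, then there is a constant $K$ such that for all $R>K$ the map $F_{h_1,h_2}$ has no zero on $\partial B_R$ and the Brouwer degree $\deg(F_{h_1,h_2},B_R,0)$ does not depend on $R$. Its value $\mathbf d_{h_1,h_2}=\lim_{R\to+\infty}\deg(F_{h_1,h_2},B_R,0)$ is $$\mathbf d_{h_1,h_2}=\begin{cases}1,&\max_V h_2<0,\\ 0,&\min_V h_2>0.\end{cases}$$ Consequently, if $\max_V h_2<0$, the Tzitzéica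 equation $-\Delta u+h_1e^{Au}+h_2e^{-Bu}=0$ has at least one solution $u:V\to\mathbb R$. -/

import Mathlib

open Filter Topology

noncomputable section

namespace Tzitzeica

section Degree

variable {E : Type*} [NormedAddCommGroup E] [NormedSpace ℝ E]

/-- The triples `(f, Ω, y)` for which the Brouwer degree is defined: `Ω` is a bounded open set,
`f` is continuous on the closure of `Ω`, and `y` is not a value of `f` on the boundary of `Ω`. -/
structure DegreeAdmissible (f : E → E) (Ω : Set E) (y : E) : Prop where
  isOpen : IsOpen Ω
  isBounded : Bornology.IsBounded Ω
  continuousOn : ContinuousOn f (closure Ω)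
  notMem_boundary : y ∉ f '' frontier Ω

/-- `f` is `C¹` in `Ω` and `y` is a regular value of `f` in `Ω`. -/
structure IsRegularOn (f : E → E) (Ω : Set E) (y : E) : Prop where
  contDiffOn : ContDiffOn ℝ 1 f Ω
  regular : ∀ x ∈ Ω, f x = y → (fderiv ℝ f x).det ≠ 0

/-- The sum of `sgn det Df(x)` over the solutions `x ∈ Ω` of `f x = y`. -/
def signedCount (f : E → E) (Ω : Set E) (y : E) : ℤ :=
  ∑ᶠ x ∈ {x | x ∈ Ω ∧ f x = y}, ((SignType.sign (fderiv ℝ f x).det : SignType) : ℤ)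

/-- `g` is an admissible regular approximation of `f`: it is continuous on the closure of `Ω`,
`C¹` in `Ω` with regular value `y`, and `sup_{closure Ω} ‖g - f‖ < dist (y, f(∂Ω))`
(both are attained, `closure Ω` and `∂Ω` being compact). -/
structure IsRegularApprox (f g : E → E) (Ω : Set E) (y : E) : Prop where
  continuousOn : ContinuousOn g (closure Ω)
  isRegularOn : IsRegularOn g Ω y
  close : ∀ x ∈ closure Ω, ∀ z ∈ frontier Ω, ‖g x - f x‖ < ‖f z - y‖

open Classical in
/-- The Brouwer degree `deg (f, Ω, y)` in a finite-dimensional space. If `f` is `C¹` in `Ω` and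
`y` is a regular value, it is the signed number of solutions of `f x = y` in `Ω`; in general it
is the signed number of solutions for a regular approximation of `f` (all of them give the same
number). The value is `0` by convention if the triple is not admissible. -/
def brouwerDegree [FiniteDimensional ℝ E] (f : E → E) (Ω : Set E) (y : E) : ℤ :=
  if DegreeAdmissible f Ω y then
    if IsRegularOn f Ω y then signedCount f Ω y
    else Classical.epsilon fun d : ℤ => ∃ g : E → E, IsRegularApprox f g Ω y ∧ signedCount g Ω y = d
  else 0

end Degree

section Graph

variable {V : Type*} [Fintype V]

/-- The Laplacian `Δu(x) = (1 / μ(x)) ∑_{y ∼ x} w_{xy} (u(y) - u(x))` of a weighted graph. -/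
def laplacian (G : SimpleGraph V) [DecidableRel G.Adj] (μ : V → ℝ) (w : V → V → ℝ)
    (u : V → ℝ) (x : V) : ℝ :=
  (1 / μ x) * ∑ y ∈ G.neighborFinset x, w x y * (u y - u x)

/-- The map `F(u) = -Δu + h₁ e^{Au} + h₂ e^{-Bu}` on `V → ℝ`, which carries the sup norm. -/
def tzitzeicaMap (G : SimpleGraph V) [DecidableRel G.Adj] (μ : V → ℝ) (w : V → V → ℝ)
    (h₁ h₂ : V → ℝ) (A B : ℝ) (u : V → ℝ) : V → ℝ := fun x =>
  -laplacian G μ w u x + h₁ x * Real.exp (A * u x) + h₂ x * Real.exp (-B * u x)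

/-- The topological degree `d_{h₁,h₂} = lim_{R → +∞} deg (F, B_R, 0)`, where `B_R` is the open
ball of radius `R` about `0` for the sup norm. -/
def tzitzeicaDegree (G : SimpleGraph V) [DecidableRel G.Adj] (μ : V → ℝ) (w : V → V → ℝ)
    (h₁ h₂ : V → ℝ) (A B : ℝ) : ℤ :=
  limUnder atTop fun R : ℝ =>
    brouwerDegree (tzitzeicaMap G μ w h₁ h₂ A B) (Metric.ball 0 R) 0

/-- The degree on large balls is well defined and independent of the radius: for all large `R`
the triple `(F, B_R, 0)` is admissible and its degree is the limit `d_{h₁,h₂}`. -/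
def DegreeWellDefined (G : SimpleGraph V) [DecidableRel G.Adj] (μ : V → ℝ) (w : V → V → ℝ)
    (h₁ h₂ : V → ℝ) (A B : ℝ) : Prop :=
  ∃ K : ℝ, ∀ R : ℝ, K < R →
    DegreeAdmissible (tzitzeicaMap G μ w h₁ h₂ A B) (Metric.ball 0 R) 0 ∧
    brouwerDegree (tzitzeicaMap G μ w h₁ h₂ A B) (Metric.ball 0 R) 0 =
      tzitzeicaDegree G μ w h₁ h₂ A B

end Graph

end Tzitzeica

end

namespace Tzitzeica

section Degree

/-! In both cases the zero set of `F` is known and `0` is a regular value, so the degree is a plain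
signed count and neither approximation nor homotopy invariance is needed. If `h₂ > 0`, summing `F(u)
= 0` against `μ` kills the Laplacian and leaves a positive sum, so there are no zeros
(`tzitzeicaMap_ne_zero`). If `h₂ < 0`, the nonlinearity is strictly increasing at each vertex and
`-Δ` is positive semidefinite for the `μ`-inner product. Hence `F` is injective, its derivative has
positive determinant, and a minimizer of a coercive energy is a zero
(`exists_tzitzeicaMap_eq_zero`). This single zero counts `+1`. -/

theorem degreeAdmissible_ball {E : Type*} [NormedAddCommGroup E] {f : E → E}
    (hf : Continuous f) {y : E} {R : ℝ} (h : ∀ x, f x = y → x ∈ Metric.ball (0 : E) R) :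
    DegreeAdmissible f (Metric.ball 0 R) y where
  isOpen := Metric.isOpen_ball
  isBounded := Metric.isBounded_ball
  continuousOn := hf.continuousOn
  notMem_boundary := by
    rintro ⟨x, hx, hxy⟩
    rw [Metric.isOpen_ball.frontier_eq] at hx
    exact hx.2 (h x hxy)

variable {E : Type*} [NormedAddCommGroup E] [NormedSpace ℝ E]

/-- The determinant of `L` is positive if no convex combination of `L` and the identity has a
nontrivial kernel. -/
theorem det_pos_of_segment_injective [FiniteDimensional ℝ E] (L : E →L[ℝ] E)
    (hL : ∀ s ∈ Set.Icc (0 : ℝ) 1, ∀ v : E, (1 - s) • v + s • L v = 0 → v = 0) :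
    0 < L.det := by
  set D : ℝ → ℝ := fun s => ((1 - s) • ContinuousLinearMap.id ℝ E + s • L).det with hD
  have hcont : Continuous D := by
    refine ContinuousLinearMap.continuous_det.comp ?_
    fun_prop
  have hne : ∀ s ∈ Set.Icc (0 : ℝ) 1, D s ≠ 0 := by
    intro s hs h0
    obtain ⟨v, hv, hv0⟩ := (Submodule.ne_bot_iff _).1
      (LinearMap.bot_lt_ker_of_det_eq_zero (f := ((((1 - s) • ContinuousLinearMap.id ℝ E + s • L :
        E →L[ℝ] E)) : E →ₗ[ℝ] E)) h0).ne'
    exact hv0 (hL s hs v (by simpa using hv))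
  have h0 : D 0 = 1 := by
    simp only [hD, sub_zero, one_smul, zero_smul, add_zero]
    exact LinearMap.det_id
  have h1 : D 1 = L.det := by simp [hD]
  -- The determinant along the segment from the identity to `L` starts at `1` and never vanishes, so
  -- it cannot change sign.
  by_contra! hneg
  rw [← h1] at hneg
  obtain ⟨s, hs, hs0⟩ := intermediate_value_Icc' (zero_le_one' ℝ) hcont.continuousOn
    (show (0 : ℝ) ∈ Set.Icc (D 1) (D 0) from ⟨hneg, by rw [h0]; exact zero_le_one⟩)
  exact hne s hs hs0

/-- A value that is never attained is vacuously regular, so the signed count is an empty sum. -/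
theorem brouwerDegree_eq_zero_of_forall_ne [FiniteDimensional ℝ E] {f : E → E}
    (hf : ContDiff ℝ 1 f) {y : E} (h : ∀ x, f x ≠ y) (R : ℝ) :
    brouwerDegree f (Metric.ball 0 R) y = 0 := by
  have hadm : DegreeAdmissible f (Metric.ball 0 R) y :=
    degreeAdmissible_ball hf.continuous fun x hx => absurd hx (h x)
  have hreg : IsRegularOn f (Metric.ball 0 R) y :=
    ⟨hf.contDiffOn, fun x _ hx => absurd hx (h x)⟩
  simp [brouwerDegree, hadm, hreg, signedCount, h]

theorem brouwerDegree_eq_one_of_unique [FiniteDimensional ℝ E] {f : E → E}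
    (hf : ContDiff ℝ 1 f) {y x₀ : E} (hx₀ : f x₀ = y) (huniq : ∀ x, f x = y → x = x₀)
    (hdet : 0 < (fderiv ℝ f x₀).det) {R : ℝ} (hR : ‖x₀‖ < R) :
    brouwerDegree f (Metric.ball 0 R) y = 1 := by
  have hball : x₀ ∈ Metric.ball (0 : E) R := by simpa using hR
  have hadm : DegreeAdmissible f (Metric.ball 0 R) y :=
    degreeAdmissible_ball hf.continuous fun x hx => huniq x hx ▸ hball
  have hreg : IsRegularOn f (Metric.ball 0 R) y :=
    ⟨hf.contDiffOn, fun x _ hx => huniq x hx ▸ hdet.ne'⟩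
  have hset : {x | x ∈ Metric.ball (0 : E) R ∧ f x = y} = {x₀} := by
    ext x
    exact ⟨fun hx => huniq x hx.2, fun hx => by
      rw [Set.mem_singleton_iff] at hx
      subst hx
      exact ⟨hball, hx₀⟩⟩
  rw [brouwerDegree, if_pos hadm, if_pos hreg, signedCount, hset, finsum_mem_singleton,
    sign_pos hdet]
  rfl

end Degree

section Graph

/-! ### Green's formula on a weighted graph -/

variable {V : Type*} [Fintype V] (G : SimpleGraph V) [DecidableRel G.Adj]
  (μ : V → ℝ) (w : V → V → ℝ)

/-- The Dirichlet form `½ ∑_{x, y} w_{xy} (u(y) - u(x)) (v(y) - v(x))` of a weighted graph. -/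
noncomputable def dirichletForm (u v : V → ℝ) : ℝ :=
  (1 / 2) * ∑ x, ∑ y ∈ G.neighborFinset x, w x y * ((u y - u x) * (v y - v x))

variable {G μ w}

theorem dirichletForm_self_nonneg (hw_pos : ∀ x y, G.Adj x y → 0 < w x y) (u : V → ℝ) :
    0 ≤ dirichletForm G w u u := by
  refine mul_nonneg (by norm_num) (Finset.sum_nonneg fun x _ => Finset.sum_nonneg fun y hy => ?_)
  exact mul_nonneg (hw_pos x y (by simpa using hy)).le (mul_self_nonneg _)

/-- Green's formula. -/
theorem sum_neg_laplacian_mul (hμ : ∀ x, 0 < μ x)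
    (hw_symm : ∀ x y, G.Adj x y → w x y = w y x) (u v : V → ℝ) :
    ∑ x, μ x * (-laplacian G μ w u x * v x) = dirichletForm G w u v := by
  have hlap : ∀ x, μ x * (-laplacian G μ w u x * v x) =
      ∑ y, if G.Adj x y then -(w x y * ((u y - u x) * v x)) else 0 := by
    intro x
    rw [← Finset.sum_filter, ← SimpleGraph.neighborFinset_eq_filter, laplacian,
      Finset.sum_neg_distrib]
    have := (hμ x).ne'
    field_simp
    rw [Finset.sum_mul]
    exact congrArg _ (Finset.sum_congr rfl fun y _ => by ring)
  -- Relabelling `x ↔ y` flips the sign of the difference of `u`. The average of the two equal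
  -- expressions is the Dirichlet form.
  have hswap : ∑ x, ∑ y, (if G.Adj x y then -(w x y * ((u y - u x) * v x)) else 0) =
      ∑ x, ∑ y, if G.Adj x y then w x y * ((u y - u x) * v y) else 0 := by
    rw [Finset.sum_comm]
    refine Finset.sum_congr rfl fun x _ => Finset.sum_congr rfl fun y _ => ?_
    simp only [G.adj_comm y x]
    split_ifs with h
    · rw [hw_symm x y h]; ring
    · rfl
  have hform : dirichletForm G w u v = (1 / 2) *
      (∑ x, ∑ y, (if G.Adj x y then w x y * ((u y - u x) * v y) else 0) +
        ∑ x, ∑ y, if G.Adj x y then -(w x y * ((u y - u x) * v x)) else 0) := by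
    rw [dirichletForm, ← Finset.sum_add_distrib]
    refine congrArg _ (Finset.sum_congr rfl fun x _ => ?_)
    rw [SimpleGraph.neighborFinset_eq_filter, Finset.sum_filter, ← Finset.sum_add_distrib]
    refine Finset.sum_congr rfl fun y _ => ?_
    split_ifs <;> ring
  rw [hform, ← hswap, Finset.sum_congr rfl fun x _ => hlap x]
  ring

theorem laplacian_sub (u v : V → ℝ) (x : V) :
    laplacian G μ w (u - v) x = laplacian G μ w u x - laplacian G μ w v x := by
  simp only [laplacian, ← mul_sub, ← Finset.sum_sub_distrib, Pi.sub_apply]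
  exact congrArg _ (Finset.sum_congr rfl fun y _ => by ring)

/-- The integral of a Laplacian vanishes. -/
theorem sum_laplacian_eq_zero (hμ : ∀ x, 0 < μ x)
    (hw_symm : ∀ x y, G.Adj x y → w x y = w y x) (u : V → ℝ) :
    ∑ x, μ x * -laplacian G μ w u x = 0 := by
  simpa [dirichletForm] using sum_neg_laplacian_mul hμ hw_symm u fun _ => 1

/-! ### The Tzitzéica map: derivative and monotonicity -/

variable {h₁ h₂ : V → ℝ} {A B : ℝ}

theorem contDiff_tzitzeicaMap : ContDiff ℝ 1 (tzitzeicaMap G μ w h₁ h₂ A B) := by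
  unfold tzitzeicaMap laplacian
  fun_prop

theorem fderiv_tzitzeicaMap_apply (u v : V → ℝ) (x : V) :
    fderiv ℝ (tzitzeicaMap G μ w h₁ h₂ A B) u v x = -laplacian G μ w v x +
      (A * h₁ x * Real.exp (A * u x) - B * h₂ x * Real.exp (-B * u x)) * v x := by
  have hF : DifferentiableAt ℝ (tzitzeicaMap G μ w h₁ h₂ A B) u :=
    contDiff_tzitzeicaMap.differentiable one_ne_zero u
  have hline : HasDerivAt (fun t : ℝ => u + t • v) v 0 := by
    simpa using ((hasDerivAt_id (0 : ℝ)).smul_const v).const_add u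
  have hcomp : HasDerivAt (fun t : ℝ => tzitzeicaMap G μ w h₁ h₂ A B (u + t • v) x)
      (fderiv ℝ (tzitzeicaMap G μ w h₁ h₂ A B) u v x) 0 := by
    have h0 : u = u + (0 : ℝ) • v := by simp
    have := HasFDerivAt.comp_hasDerivAt (0 : ℝ) (h0 ▸ hF.hasFDerivAt) hline
    rw [hasDerivAt_pi] at this
    simpa using this x
  have hcoord : ∀ y, HasDerivAt (fun t : ℝ => (u + t • v) y) (v y) 0 :=
    fun y => hasDerivAt_pi.1 hline y
  have hlap : HasDerivAt (fun t : ℝ => laplacian G μ w (u + t • v) x) (laplacian G μ w v x) 0 :=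
    (HasDerivAt.fun_sum fun y _ => ((hcoord y).sub (hcoord x)).const_mul (w x y)).const_mul _
  have hexp : ∀ c : ℝ, HasDerivAt (fun t : ℝ => Real.exp (c * (u + t • v) x))
      (Real.exp (c * u x) * (c * v x)) 0 := fun c => by
    simpa using ((hcoord x).const_mul c).exp
  have h : HasDerivAt (fun t : ℝ => tzitzeicaMap G μ w h₁ h₂ A B (u + t • v) x) _ 0 :=
    (hlap.neg.add ((hexp A).const_mul (h₁ x))).add ((hexp (-B)).const_mul (h₂ x))
  exact (hcomp.unique h).trans (by ring)

/-- If `h₂ > 0`, the equation has no solution: the integral of `F(u)` is positive. -/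
theorem tzitzeicaMap_ne_zero [Nonempty V] (hμ : ∀ x, 0 < μ x)
    (hw_symm : ∀ x y, G.Adj x y → w x y = w y x)
    (hh₁ : ∀ x, 0 < h₁ x) (hh₂ : ∀ x, 0 < h₂ x) (u : V → ℝ) :
    tzitzeicaMap G μ w h₁ h₂ A B u ≠ 0 := by
  intro hu
  have hsum : ∑ x, μ x * tzitzeicaMap G μ w h₁ h₂ A B u x = 0 := by simp [hu]
  have hpos : 0 < ∑ x, μ x * (h₁ x * Real.exp (A * u x) + h₂ x * Real.exp (-B * u x)) :=
    Finset.sum_pos (fun x _ => by have := hμ x; have := hh₁ x; have := hh₂ x; positivity)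
      Finset.univ_nonempty
  simp only [tzitzeicaMap, add_assoc, mul_add (μ _) (-_), Finset.sum_add_distrib] at hsum
  rw [sum_laplacian_eq_zero hμ hw_symm] at hsum
  linarith

/-- If `h₂ < 0`, the linearization of `F` is positive for the inner product weighted by `μ`, so
its determinant is positive. -/
theorem det_fderiv_tzitzeicaMap_pos (hμ : ∀ x, 0 < μ x)
    (hw_symm : ∀ x y, G.Adj x y → w x y = w y x) (hw_pos : ∀ x y, G.Adj x y → 0 < w x y)
    (hh₁ : ∀ x, 0 < h₁ x) (hh₂ : ∀ x, h₂ x < 0) (hA : 0 < A) (hB : 0 < B) (u : V → ℝ) :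
    0 < (fderiv ℝ (tzitzeicaMap G μ w h₁ h₂ A B) u).det := by
  refine det_pos_of_segment_injective _ fun s hs v hv => ?_
  set c : V → ℝ := fun x => A * h₁ x * Real.exp (A * u x) - B * h₂ x * Real.exp (-B * u x)
  have hc : ∀ x, 0 < c x := fun x => by
    have h1 : 0 < A * h₁ x * Real.exp (A * u x) := by have := hh₁ x; positivity
    have h2 : 0 < B * -h₂ x * Real.exp (-B * u x) := by
      have := neg_pos.2 (hh₂ x); positivity
    simp only [c]
    linarith
  have hsc : ∀ x, 0 < 1 - s + s * c x := fun x => by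
    rcases hs.1.eq_or_lt with rfl | h
    · simp
    · have := mul_pos h (hc x)
      linarith [hs.2]
  -- Pair the kernel equation with `v` in the `μ`-inner product; both resulting terms are
  -- nonnegative.
  have hzero : s * dirichletForm G w v v + ∑ x, μ x * (1 - s + s * c x) * v x ^ 2 = 0 := by
    rw [← sum_neg_laplacian_mul hμ hw_symm, Finset.mul_sum, ← Finset.sum_add_distrib]
    refine Finset.sum_eq_zero fun x _ => ?_
    have := congrFun hv x
    simp only [Pi.add_apply, Pi.smul_apply, smul_eq_mul, fderiv_tzitzeicaMap_apply,
      Pi.zero_apply] at this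
    linear_combination (μ x * v x) * this
  have hterm : ∀ x ∈ Finset.univ, 0 ≤ μ x * (1 - s + s * c x) * v x ^ 2 := fun x _ => by
    have := hμ x; have := hsc x; positivity
  have hsum := (Finset.sum_eq_zero_iff_of_nonneg hterm).1 <| le_antisymm
    (by linarith [mul_nonneg hs.1 (dirichletForm_self_nonneg hw_pos v)])
    (Finset.sum_nonneg hterm)
  ext x
  simpa [(hμ x).ne', (hsc x).ne'] using hsum x (Finset.mem_univ x)

/-- If `h₂ < 0`, then `F` is injective. -/
theorem tzitzeicaMap_injective (hμ : ∀ x, 0 < μ x)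
    (hw_symm : ∀ x y, G.Adj x y → w x y = w y x) (hw_pos : ∀ x y, G.Adj x y → 0 < w x y)
    (hh₁ : ∀ x, 0 < h₁ x) (hh₂ : ∀ x, h₂ x < 0) (hA : 0 < A) (hB : 0 < B) :
    Function.Injective (tzitzeicaMap G μ w h₁ h₂ A B) := by
  intro u v huv
  set f : V → ℝ → ℝ := fun x t => h₁ x * Real.exp (A * t) + h₂ x * Real.exp (-B * t)
  have hf : ∀ x, StrictMono (f x) := fun x s t hst => by
    have h1 : Real.exp (A * s) < Real.exp (A * t) := by gcongr
    have h2 : Real.exp (-B * t) < Real.exp (-B * s) :=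
      Real.exp_lt_exp.2 (mul_lt_mul_of_neg_left hst (neg_neg_of_pos hB))
    exact add_lt_add (mul_lt_mul_of_pos_left h1 (hh₁ x)) (mul_lt_mul_of_neg_left h2 (hh₂ x))
  have hprod : ∀ x, u x ≠ v x → 0 < (f x (u x) - f x (v x)) * (u x - v x) := fun x hx => by
    rcases hx.lt_or_gt with h | h
    · exact mul_pos_of_neg_of_neg (sub_neg.2 (hf x h)) (sub_neg.2 h)
    · exact mul_pos (sub_pos.2 (hf x h)) (sub_pos.2 h)
  have hterm : ∀ x ∈ Finset.univ, 0 ≤ μ x * ((f x (u x) - f x (v x)) * (u x - v x)) :=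
    fun x _ => mul_nonneg (hμ x).le <| by
      by_cases h : u x = v x
      · simp [h]
      · exact (hprod x h).le
  -- Pair `F(u) - F(v) = 0` with `u - v` in the `μ`-inner product.
  have hzero : dirichletForm G w (u - v) (u - v) +
      ∑ x, μ x * ((f x (u x) - f x (v x)) * (u x - v x)) = 0 := by
    rw [← sum_neg_laplacian_mul hμ hw_symm, ← Finset.sum_add_distrib]
    refine Finset.sum_eq_zero fun x _ => ?_
    have := congrFun huv x
    simp only [tzitzeicaMap] at this
    simp only [laplacian_sub, Pi.sub_apply, f]
    linear_combination (μ x * (u x - v x)) * this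
  have hsum := (Finset.sum_eq_zero_iff_of_nonneg hterm).1 <| le_antisymm
    (by linarith [dirichletForm_self_nonneg hw_pos (u - v)]) (Finset.sum_nonneg hterm)
  ext x
  by_contra hx
  exact (mul_pos (hμ x) (hprod x hx)).ne' (hsum x (Finset.mem_univ x))

/-! ### Existence by minimization -/

variable (G μ w h₁ h₂ A B) in
/-- The energy whose Euler–Lagrange equation is `F(u) = 0`. -/
noncomputable def energy (u : V → ℝ) : ℝ :=
  (1 / 2) * dirichletForm G w u u +
    ∑ x, μ x * (h₁ x / A * Real.exp (A * u x) - h₂ x / B * Real.exp (-B * u x))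

theorem continuous_energy : Continuous (energy G μ w h₁ h₂ A B) := by
  unfold energy dirichletForm
  fun_prop

theorem hasDerivAt_energy (hμ : ∀ x, 0 < μ x) (hw_symm : ∀ x y, G.Adj x y → w x y = w y x)
    (hA : A ≠ 0) (hB : B ≠ 0) (u v : V → ℝ) :
    HasDerivAt (fun t : ℝ => energy G μ w h₁ h₂ A B (u + t • v))
      (∑ x, μ x * (tzitzeicaMap G μ w h₁ h₂ A B u x * v x)) 0 := by
  have hline : HasDerivAt (fun t : ℝ => u + t • v) v 0 := by
    simpa using ((hasDerivAt_id (0 : ℝ)).smul_const v).const_add u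
  have hcoord : ∀ y, HasDerivAt (fun t : ℝ => (u + t • v) y) (v y) 0 :=
    fun y => hasDerivAt_pi.1 hline y
  have hform : HasDerivAt (fun t : ℝ => dirichletForm G w (u + t • v) (u + t • v))
      (2 * dirichletForm G w u v) 0 := by
    have h : HasDerivAt (fun t : ℝ => dirichletForm G w (u + t • v) (u + t • v)) _ 0 :=
      (HasDerivAt.fun_sum fun x _ => HasDerivAt.fun_sum fun y _ =>
      (((hcoord y).sub (hcoord x)).mul ((hcoord y).sub (hcoord x))).const_mul
        (w x y)).const_mul (1 / 2)
    convert h using 1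
    rw [dirichletForm, mul_left_comm, Finset.mul_sum]
    refine congrArg _ (Finset.sum_congr rfl fun x _ => ?_)
    rw [Finset.mul_sum]
    exact Finset.sum_congr rfl fun y _ => by simp; ring
  have hexp : ∀ x, ∀ c : ℝ, HasDerivAt (fun t : ℝ => Real.exp (c * (u + t • v) x))
      (Real.exp (c * u x) * (c * v x)) 0 := fun x c => by
    simpa using ((hcoord x).const_mul c).exp
  have h : HasDerivAt (fun t : ℝ => energy G μ w h₁ h₂ A B (u + t • v)) _ 0 :=
    (hform.const_mul (1 / 2)).add (HasDerivAt.fun_sum fun x _ =>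
    (((hexp x A).const_mul (h₁ x / A)).sub ((hexp x (-B)).const_mul (h₂ x / B))).const_mul (μ x))
  convert h using 1
  rw [← mul_assoc, one_div_mul_cancel two_ne_zero, one_mul,
    ← sum_neg_laplacian_mul hμ hw_symm, ← Finset.sum_add_distrib]
  refine Finset.sum_congr rfl fun x _ => ?_
  simp only [tzitzeicaMap]
  field_simp
  ring

/-- Every term of the energy is nonnegative, and at each vertex one exponential controls `u x` and
the other `-u x`. The energy therefore dominates a multiple of the sup norm. -/
theorem tendsto_energy_cocompact [Nonempty V] (hμ : ∀ x, 0 < μ x)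
    (hw_pos : ∀ x y, G.Adj x y → 0 < w x y)
    (hh₁ : ∀ x, 0 < h₁ x) (hh₂ : ∀ x, h₂ x < 0) (hA : 0 < A) (hB : 0 < B) :
    Tendsto (energy G μ w h₁ h₂ A B) (cocompact (V → ℝ)) atTop := by
  obtain ⟨x₀, hx₀⟩ := Finite.exists_min fun x => min (μ x * h₁ x) (μ x * -h₂ x)
  set c := min (μ x₀ * h₁ x₀) (μ x₀ * -h₂ x₀)
  have hc : 0 < c := lt_min (mul_pos (hμ _) (hh₁ _)) (mul_pos (hμ _) (neg_pos.2 (hh₂ _)))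
  refine tendsto_atTop_mono (fun u => ?_) ((tendsto_norm_cocompact_atTop).const_mul_atTop hc)
  have hexp : ∀ a t : ℝ, 0 < a → t ≤ Real.exp (a * t) / a := fun a t ha => by
    rw [le_div_iff₀ ha]
    linarith [Real.add_one_le_exp (a * t)]
  have hterm : ∀ x, μ x * (h₁ x / A * Real.exp (A * u x) - h₂ x / B * Real.exp (-B * u x)) =
      μ x * h₁ x * (Real.exp (A * u x) / A) + μ x * -h₂ x * (Real.exp (B * -u x) / B) :=
    fun x => by rw [neg_mul, mul_neg B]; ring
  have hpos₁ : ∀ x, 0 < μ x * h₁ x := fun x => mul_pos (hμ _) (hh₁ _)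
  have hpos₂ : ∀ x, 0 < μ x * -h₂ x := fun x => mul_pos (hμ _) (neg_pos.2 (hh₂ _))
  have hE₁ : ∀ x, 0 < Real.exp (A * u x) / A := fun x => by positivity
  have hE₂ : ∀ x, 0 < Real.exp (B * -u x) / B := fun x => by positivity
  have hlower : ∀ x, c * |u x| ≤ energy G μ w h₁ h₂ A B u := fun x => by
    have hsingle := Finset.single_le_sum (f := fun x => μ x *
        (h₁ x / A * Real.exp (A * u x) - h₂ x / B * Real.exp (-B * u x)))
      (fun y _ => by
        rw [hterm]
        exact (add_pos (mul_pos (hpos₁ y) (hE₁ y)) (mul_pos (hpos₂ y) (hE₂ y))).le)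
      (Finset.mem_univ x)
    have hform := dirichletForm_self_nonneg hw_pos u
    refine le_trans ?_ (hsingle.trans (le_add_of_nonneg_left (by positivity)))
    simp only [hterm]
    have h1 := mul_le_mul ((hx₀ x).trans (min_le_left _ _)) le_rfl (hE₁ x).le (hpos₁ x).le
    have h2 := mul_le_mul ((hx₀ x).trans (min_le_right _ _)) le_rfl (hE₂ x).le (hpos₂ x).le
    rcases abs_cases (u x) with ⟨h, -⟩ | ⟨h, -⟩ <;> rw [h]
    · have := mul_le_mul_of_nonneg_left (hexp A (u x) hA) hc.le
      linarith [mul_pos (hpos₂ x) (hE₂ x)]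
    · have := mul_le_mul_of_nonneg_left (hexp B (-u x) hB) hc.le
      linarith [mul_pos (hpos₁ x) (hE₁ x)]
  have hnorm : ‖u‖ ≤ energy G μ w h₁ h₂ A B u / c :=
    (pi_norm_le_iff_of_nonempty _).2 fun x => by
      rw [le_div_iff₀ hc, mul_comm]
      exact hlower x
  rw [le_div_iff₀ hc] at hnorm
  linarith

/-- If `h₂ < 0`, the equation has a solution, a minimizer of the energy. -/
theorem exists_tzitzeicaMap_eq_zero [Nonempty V] (hμ : ∀ x, 0 < μ x)
    (hw_symm : ∀ x y, G.Adj x y → w x y = w y x) (hw_pos : ∀ x y, G.Adj x y → 0 < w x y)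
    (hh₁ : ∀ x, 0 < h₁ x) (hh₂ : ∀ x, h₂ x < 0) (hA : 0 < A) (hB : 0 < B) :
    ∃ u, tzitzeicaMap G μ w h₁ h₂ A B u = 0 := by
  classical
  obtain ⟨u, hu⟩ := (continuous_energy (G := G) (μ := μ) (w := w) (h₁ := h₁) (h₂ := h₂)
    (A := A) (B := B)).exists_forall_le (tendsto_energy_cocompact hμ hw_pos hh₁ hh₂ hA hB)
  refine ⟨u, funext fun x => ?_⟩
  -- Varying `u` at the single vertex `x` makes the derivative of the energy equal to `μ x` times
  -- `F(u)(x)`.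
  have hmin : IsLocalMin (fun t : ℝ => energy G μ w h₁ h₂ A B (u + t • Pi.single x 1)) 0 :=
    Eventually.of_forall fun t => by simpa using hu _
  have h := hmin.hasDerivAt_eq_zero (hasDerivAt_energy hμ hw_symm hA.ne' hB.ne' u _)
  simpa [Pi.single_apply, (hμ x).ne'] using h

theorem tzitzeicaDegree_eq_of_forall_gt {K : ℝ} {d : ℤ}
    (h : ∀ R, K < R → brouwerDegree (tzitzeicaMap G μ w h₁ h₂ A B) (Metric.ball 0 R) 0 = d) :
    tzitzeicaDegree G μ w h₁ h₂ A B = d :=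
  (tendsto_const_nhds.congr' <| (eventually_gt_atTop K).mono fun R hR => (h R hR).symm).limUnder_eq

end Graph

end Tzitzeica

theorem theorem1 {V : Type*} [Fintype V] (G : SimpleGraph V) [DecidableRel G.Adj]
    (hG : G.Connected)
    (μ : V → ℝ) (hμ : ∀ x, 0 < μ x)
    (w : V → V → ℝ) (hw_symm : ∀ x y, G.Adj x y → w x y = w y x)
    (hw_pos : ∀ x y, G.Adj x y → 0 < w x y)
    (h₁ h₂ : V → ℝ) (hh₁ : ∀ x, 0 < h₁ x)
    (A B : ℝ) (hA : 0 < A) (hB : 0 < B) :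
    ((∀ x, h₂ x < 0) →
      Tzitzeica.DegreeWellDefined G μ w h₁ h₂ A B ∧
      Tzitzeica.tzitzeicaDegree G μ w h₁ h₂ A B = 1 ∧
      ∃ u : V → ℝ, ∀ x,
        -Tzitzeica.laplacian G μ w u x + h₁ x * Real.exp (A * u x)
          + h₂ x * Real.exp (-B * u x) = 0) ∧
    ((∀ x, 0 < h₂ x) →
      Tzitzeica.DegreeWellDefined G μ w h₁ h₂ A B ∧
      Tzitzeica.tzitzeicaDegree G μ w h₁ h₂ A B = 0) := by
  -- A vertex is needed for the sum excluding zeros to be strictly positive.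
  have := hG.nonempty
  refine ⟨fun hh₂ => ?_, fun hh₂ => ?_⟩
  · obtain ⟨u, hu⟩ := Tzitzeica.exists_tzitzeicaMap_eq_zero hμ hw_symm hw_pos hh₁ hh₂ hA hB
    have huniq : ∀ v, Tzitzeica.tzitzeicaMap G μ w h₁ h₂ A B v = 0 → v = u := fun v hv =>
      Tzitzeica.tzitzeicaMap_injective hμ hw_symm hw_pos hh₁ hh₂ hA hB (hv.trans hu.symm)
    have hdeg : ∀ R, ‖u‖ < R → Tzitzeica.brouwerDegree
        (Tzitzeica.tzitzeicaMap G μ w h₁ h₂ A B) (Metric.ball 0 R) 0 = 1 := fun R hR =>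
      Tzitzeica.brouwerDegree_eq_one_of_unique Tzitzeica.contDiff_tzitzeicaMap hu huniq
        (Tzitzeica.det_fderiv_tzitzeicaMap_pos hμ hw_symm hw_pos hh₁ hh₂ hA hB u) hR
    have hlim := Tzitzeica.tzitzeicaDegree_eq_of_forall_gt hdeg
    refine ⟨⟨‖u‖, fun R hR => ⟨Tzitzeica.degreeAdmissible_ball
      Tzitzeica.contDiff_tzitzeicaMap.continuous fun v hv => ?_, (hdeg R hR).trans hlim.symm⟩⟩,
      hlim, u, congrFun hu⟩
    rw [huniq v hv]
    simpa using hR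
  · have hne := Tzitzeica.tzitzeicaMap_ne_zero (A := A) (B := B) hμ hw_symm hh₁ hh₂
    have hdeg : ∀ R : ℝ, 0 < R → Tzitzeica.brouwerDegree
        (Tzitzeica.tzitzeicaMap G μ w h₁ h₂ A B) (Metric.ball 0 R) 0 = 0 := fun R _ =>
      Tzitzeica.brouwerDegree_eq_zero_of_forall_ne Tzitzeica.contDiff_tzitzeicaMap hne R
    have hlim := Tzitzeica.tzitzeicaDegree_eq_of_forall_gt hdeg
    exact ⟨⟨0, fun R hR => ⟨Tzitzeica.degreeAdmissible_ball
      Tzitzeica.contDiff_tzitzeicaMap.continuous fun v hv => absurd hv (hne v),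
      (hdeg R hR).trans hlim.symm⟩⟩, hlim⟩
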